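/- All graphs are finite and simple. A \emph{cover} of a graph $G$ is a pair $\mathcal{H}=(L,H)$ of a graph $H$ and a map $L\colon V(G)\to\mathcal{P}(V(H))$ such that the sets $L(u)$, $u\in V(G)$, partition $V(H)$; each $L(u)$ induces a complete subgraph of $H$; if $H$ has an edge between $L(u)$ and $L(v)$, then $u=v$ or $uv\in E(G)$; and for each $uv\in E(G)$ the edges of $H$ between $L(u)$ and $L(v)$ form a (possibly empty) matching. The cover is $k$-\emph{fold} if $|L(u)|=k$ for all $u\in V(G)$. For $\eta\in[0,1]$, an $(\eta,\mathcal{H})$-\emph{coloring} of $G$ is a set $S\subseteq V(H)$ that spans no edge of $H$ between distinct parts $L(u)$, $L(v)$ and satisfies $|S\cap L(u)|\ge\eta|L(u)|$ for all $u\in V(G)$. For $k\ge 1$ let $\theta_{DP}(G,k)$ be the largest $\eta\in[0,1]$ such that $G$ has an $(\eta,\mathcal{H})$-coloring for every $k$-fold cover $\mathcal{H}$ of $G$, and let the \emph{fractional DP-chromatic number} of $G$ be $$\chi^*_{DP}(G)=\inf\{\theta_{DP}(G,k)^{-1} : k\ge 1\}\qquad(\text{with } 0^{-1}=\infty).$$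 A graph is $d$-\emph{degenerate} if it has an orientation without directed cycles in which every out-degree is at most $d$. (i) There is a function $\delta\colon\mathbb{N}\to\mathbb{R}$ with $\delta(d)\to 0$ as $d\to\infty$ such that for every integer $d\ge 2$, every $d$-degenerate bipartite graph $G$ satisfies $$\chi^*_{DP}(G)\le(1+\delta(d))\,\frac{d}{\ln d}.$$ (ii) The constant factor $1$ in (i) is sharp, as witnessed by complete bipartite graphs: for every function $\omega\colon\mathbb{N}\to\mathbb{N}$ with $\omega(d)/d\to\infty$ as $d\to\infty$, there is a function $\delta\colon\mathbb{N}\to\mathbb{R}$ with $\delta(d)\to0$ as $d\to\infty$ such that for every integer $d\ge2$ $$\chi^*_{DP}(K_{d,\omega(d)})=(1+\delta(d))\,\frac{d}{\ln d}.$$ -/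

import Mathlib

open Filter Topology
open scoped ENNReal

universe u

namespace FracDP

/-- A cover `(L, H)` of a graph `G`, where `H` is a graph on the vertex set `W`. -/
structure Cover {V : Type u} (G : SimpleGraph V) (W : Type u) where
  /-- The graph `H`. -/
  H : SimpleGraph W
  /-- The lists `L(u) ⊆ V(H)`. -/
  L : V → Finset W
  /-- The lists partition the vertex set of `H`. -/
  partition : ∀ x : W, ∃! u : V, x ∈ L u
  /-- Every list induces a complete subgraph of `H`. -/
  complete : ∀ u : V, ∀ x ∈ L u, ∀ y ∈ L u, x ≠ y → H.Adj x y
  /-- Edges of `H` run within a list or between the lists of two adjacent vertices. -/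
  edge : ∀ u v : V, ∀ x ∈ L u, ∀ y ∈ L v, H.Adj x y → u = v ∨ G.Adj u v
  /-- The edges of `H` between the lists of two adjacent vertices form a (not necessarily perfect)
  matching. The condition is imposed for `(u, v)` and for `(v, u)`, hence on both sides. -/
  matching : ∀ u v : V, G.Adj u v → ∀ x ∈ L u, ∀ y ∈ L v, ∀ z ∈ L v,
    H.Adj x y → H.Adj x z → y = z

namespace Cover

variable {V W : Type u} {G : SimpleGraph V}

/-- The cover is `k`-fold if all lists have size `k`. -/
def IsFold (C : Cover G W) (k : ℕ) : Prop :=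
  ∀ u : V, (C.L u).card = k

/-- `S ⊆ V(H)` is quasi-independent if it spans no cross-edge, that is, no edge of `H` between the
lists of two distinct vertices. -/
def QuasiIndependent (C : Cover G W) (S : Set W) : Prop :=
  ∀ u v : V, u ≠ v → ∀ x ∈ S, ∀ y ∈ S, x ∈ C.L u → y ∈ C.L v → ¬ C.H.Adj x y

/-- `S` is an `(η, (L, H))`-coloring of `G`. -/
def IsFracColoring (C : Cover G W) (η : ℝ) (S : Set W) : Prop :=
  C.QuasiIndependent S ∧ ∀ u : V, η * ((C.L u).card : ℝ) ≤ ((S ∩ (C.L u : Set W)).ncard : ℝ)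

end Cover

/-- `θ_DP(G, k)`: the largest `η ∈ [0, 1]` such that `G` has an `(η, (L, H))`-coloring for every
`k`-fold cover `(L, H)` of `G`. For finite `G` every `k`-fold cover is finite, so that letting
`V(H)` range over the types in the universe of `V(G)` covers all of them up to isomorphism. -/
noncomputable def thetaDP {V : Type u} (G : SimpleGraph V) (k : ℕ) : ℝ :=
  sSup {η : ℝ | 0 ≤ η ∧ η ≤ 1 ∧
    ∀ (W : Type u) (C : Cover G W), C.IsFold k → ∃ S : Set W, C.IsFracColoring η S}

/-- The fractional DP-chromatic number `χ*_DP(G) = inf {θ_DP(G, k)⁻¹ : k ≥ 1}`. The infimum is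
taken in `[0, ∞]`, so that a value of `k` with `θ_DP(G, k) = 0` contributes `0⁻¹ = ∞`. -/
noncomputable def chiDP {V : Type u} (G : SimpleGraph V) : ℝ≥0∞ :=
  ⨅ (k : ℕ) (_ : 1 ≤ k), (ENNReal.ofReal (thetaDP G k))⁻¹

/-- The digraph `D` is an orientation of the graph `G`: every edge of `G` gets exactly one of its
two directions, and `D` has no other edges. -/
def IsOrientation {V : Type u} (G : SimpleGraph V) (D : Digraph V) : Prop :=
  (∀ u v : V, G.Adj u v ↔ D.Adj u v ∨ D.Adj v u) ∧ ∀ u v : V, D.Adj u v → ¬ D.Adj v u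

/-- `D` has no directed cycles: no vertex is reachable from itself by a directed walk of positive
length. -/
def IsAcyclicDigraph {V : Type u} (D : Digraph V) : Prop :=
  ∀ u : V, ¬ Relation.TransGen D.Adj u u

/-- `G` is `d`-degenerate: it has an acyclic orientation with all out-degrees at most `d`. -/
def IsDegenerate {V : Type u} (G : SimpleGraph V) (d : ℕ) : Prop :=
  ∃ D : Digraph V, IsOrientation G D ∧ IsAcyclicDigraph D ∧
    ∀ u : V, {v : V | D.Adj u v}.encard ≤ d

end FracDP

/-!
Upper bound. Orient `G` acyclically with out-degrees at most `d` and lift the orientation to the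
cross-edges of the cover. Every `x ∈ V(H)` flips an independent coin of bias `p x`, and `x` is
selected if its coin is favourable and none of its out-neighbours is selected. As `G` is bipartite,
one can let heads be favourable on one side and tails on the other. Then the selection events on one
side are increasing and those on the other are decreasing, so that by Harris' inequality no
out-neighbour of `x` is selected with probability at least `(1 - η) ^ d`, where `η` is the common
selection probability of the vertices treated before. If `η = (1 - η) ^ d`, the bias of `x` can thus
be chosen such that `x` is selected with probability exactly `η`, and this root satisfies
`η ≥ (1 - o(1)) ln d / d`. The selection of `x` depends only on the coins in a ball whose size is
bounded in terms of `G` alone. As the lists grow, Chebyshev's inequality therefore yields an outcome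
in which all lists have almost the expected proportion `η` of selected vertices.

Lower bound. Cover every edge of `K_{a, b}` by an independent uniform random perfect matching. For
fixed sets of `s` vertices in each of the `a + b` lists, each edge is conflict-free with probability
at most `exp (-s ^ 2 / k)`, so by a union bound over the `(k.choose s) ^ (a + b)` choices a coloring
with `s = ⌈η k⌉` can exist for all matchings only if `η a b ≤ (a + b) (1 - ln η)`.
-/

namespace FracDP

open MeasureTheory ProbabilityTheory

/-! ### Product measures and concentration -/

section ProductMeasure

variable {ι : Type*} {Ω : ι → Type*} [∀ i, MeasurableSpace (Ω i)]

theorem exists_measurable_comp_domRestrict_of_dependsOn [∀ i, Nonempty (Ω i)] {β : Type*}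
    [MeasurableSpace β] {X : (∀ i, Ω i) → β} (hX : Measurable X) {S : Set ι}
    (hS : DependsOn X S) : ∃ g : (∀ i : S, Ω i) → β, Measurable g ∧ X = g ∘ S.domRestrict := by
  classical
  obtain ⟨ω₀⟩ : Nonempty (∀ i, Ω i) := inferInstance
  let e : (∀ i : S, Ω i) → ∀ i, Ω i := fun y i => if h : i ∈ S then y ⟨i, h⟩ else ω₀ i
  have he : Measurable e := by
    refine measurable_pi_lambda _ fun i => ?_
    by_cases h : i ∈ S
    · simpa only [e, h, dif_pos] using measurable_pi_apply (⟨i, h⟩ : S)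
    · simpa only [e, h, dif_neg, not_false_eq_true] using measurable_const
  refine ⟨X ∘ e, hX.comp he, funext fun ω => hS fun i hi => ?_⟩
  simp [e, hi]

variable [Fintype ι] {μ ν : ∀ i, Measure (Ω i)} [∀ i, IsProbabilityMeasure (μ i)]
  [∀ i, IsProbabilityMeasure (ν i)]

theorem indepFun_pi_of_dependsOn {β γ : Type*} [MeasurableSpace β] [MeasurableSpace γ]
    {X : (∀ i, Ω i) → β} {Y : (∀ i, Ω i) → γ} (hX : Measurable X) (hY : Measurable Y)
    {S T : Set ι} (hS : DependsOn X S) (hT : DependsOn Y T) (hST : Disjoint S T) :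
    IndepFun X Y (Measure.pi μ) := by
  classical
  have (i : ι) : Nonempty (Ω i) := nonempty_of_isProbabilityMeasure (μ i)
  lift S to Finset ι using S.toFinite
  lift T to Finset ι using T.toFinite
  obtain ⟨f, hf, rfl⟩ := exists_measurable_comp_domRestrict_of_dependsOn hX hS
  obtain ⟨g, hg, rfl⟩ := exists_measurable_comp_domRestrict_of_dependsOn hY hT
  have hind : iIndepFun (fun i (ω : ∀ i, Ω i) => ω i) (Measure.pi μ) :=
    iIndepFun_pi (X := fun _ => id) fun _ => aemeasurable_id
  exact (hind.indepFun_finset S T (Finset.disjoint_coe.1 hST) measurable_pi_apply).comp hf hg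

theorem pi_apply_eq_of_dependsOn {A : Set (∀ i, Ω i)} (hA : MeasurableSet A) {S : Set ι}
    (hS : DependsOn (· ∈ A) S) (h : ∀ i ∈ S, μ i = ν i) : Measure.pi μ A = Measure.pi ν A := by
  have (i : ι) : Nonempty (Ω i) := nonempty_of_isProbabilityMeasure (μ i)
  obtain ⟨g, hg, hgA⟩ := exists_measurable_comp_domRestrict_of_dependsOn hA.mem hS
  have hpre : A = S.domRestrict ⁻¹' {y | g y} := Set.ext fun ω => iff_of_eq (congrFun hgA ω)
  have key (κ : ∀ i, Measure (Ω i)) [∀ i, IsProbabilityMeasure (κ i)] :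
      Measure.pi κ A = Measure.infinitePi (fun i : S => κ i) {y | g y} := by
    rw [← Measure.infinitePi_map_restrict', Measure.map_apply (by fun_prop) hg.setOf, ← hpre,
      Measure.infinitePi_eq_pi]
  rw [key, key, funext fun i : S => h i i.2]

end ProductMeasure

section Harris

variable {ι : Type*} [Fintype ι] {Ω : ι → Type*} [∀ i, LinearOrder (Ω i)] [∀ i, Finite (Ω i)]
  [∀ i, MeasurableSpace (Ω i)] [∀ i, MeasurableSingletonClass (Ω i)] {μ : ∀ i, Measure (Ω i)}
  [∀ i, IsProbabilityMeasure (μ i)]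

theorem monotone_indicator_one_of_isUpperSet {α : Type*} [Preorder α] {S : Set α}
    (hS : IsUpperSet S) : Monotone (S.indicator (1 : α → ℝ)) := by
  intro a b hab
  by_cases ha : a ∈ S
  · rw [Set.indicator_of_mem ha, Set.indicator_of_mem (hS hab ha)]
    rfl
  · rw [Set.indicator_of_notMem ha]
    exact Set.indicator_nonneg (fun _ _ => zero_le_one) b

theorem measureReal_mul_le_measureReal_inter_of_isUpperSet {A B : Set (∀ i, Ω i)}
    (hA : IsUpperSet A) (hB : IsUpperSet B) :
    (Measure.pi μ).real A * (Measure.pi μ).real B ≤ (Measure.pi μ).real (A ∩ B) := by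
  classical
  have (i : ι) : Fintype (Ω i) := Fintype.ofFinite _
  have hsum (S : Set (∀ i, Ω i)) :
      ∑ ω, (Measure.pi μ).real {ω} * S.indicator 1 ω = (Measure.pi μ).real S := by
    rw [← integral_indicator_one S.toFinite.measurableSet, integral_fintype .of_finite]
    rfl
  have hsub (a b : ∀ i, Ω i) : (Measure.pi μ).real {a} * (Measure.pi μ).real {b} ≤
      (Measure.pi μ).real {a ⊓ b} * (Measure.pi μ).real {a ⊔ b} := by
    simp only [measureReal_def, Measure.pi_singleton, ENNReal.toReal_prod,
      ← Finset.prod_mul_distrib]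
    refine (Finset.prod_congr rfl fun i _ => ?_).le
    rcases le_total (a i) (b i) with h | h <;> simp [h, mul_comm]
  have hnonneg (S : Set (∀ i, Ω i)) : 0 ≤ S.indicator (1 : (∀ i, Ω i) → ℝ) :=
    Set.indicator_nonneg fun _ _ => zero_le_one
  have hfkg := fkg _ _ (fun ω => (Measure.pi μ).real {ω}) (fun _ => measureReal_nonneg)
    (hnonneg A) (hnonneg B) (monotone_indicator_one_of_isUpperSet hA)
    (monotone_indicator_one_of_isUpperSet hB) hsub
  have hinter (ω) : A.indicator 1 ω * B.indicator 1 ω = (A ∩ B).indicator (M := ℝ) 1 ω :=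
    (congrFun Set.inter_indicator_one ω).symm
  simpa only [hsum, hinter, sum_measureReal_singleton, Finset.coe_univ, probReal_univ, one_mul]
    using hfkg

theorem measureReal_mul_le_measureReal_inter_of_isLowerSet {A B : Set (∀ i, Ω i)}
    (hA : IsLowerSet A) (hB : IsLowerSet B) :
    (Measure.pi μ).real A * (Measure.pi μ).real B ≤ (Measure.pi μ).real (A ∩ B) := by
  have hmeas (S : Set (∀ i, Ω i)) : MeasurableSet S := S.toFinite.measurableSet
  have h := measureReal_mul_le_measureReal_inter_of_isUpperSet (μ := μ) hA.compl hB.compl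
  have hunion := measureReal_union_add_inter (μ := Measure.pi μ) (s := A) (hmeas B)
  rw [← Set.compl_union, probReal_compl_eq_one_sub (hmeas A), probReal_compl_eq_one_sub (hmeas B),
    probReal_compl_eq_one_sub (hmeas (A ∪ B))] at h
  linarith

theorem prod_measureReal_le_measureReal_biInter {κ : Type*} (s : Finset κ)
    {A : κ → Set (∀ i, Ω i)} (h : (∀ j ∈ s, IsUpperSet (A j)) ∨ ∀ j ∈ s, IsLowerSet (A j)) :
    ∏ j ∈ s, (Measure.pi μ).real (A j) ≤ (Measure.pi μ).real (⋂ j ∈ s, A j) := by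
  classical
  induction s using Finset.induction_on with
  | empty => simp
  | insert j s hj ih =>
    simp only [Finset.forall_mem_insert] at h
    rw [Finset.prod_insert hj, Finset.set_biInter_insert]
    refine (mul_le_mul_of_nonneg_left (ih (h.imp And.right And.right))
      measureReal_nonneg).trans ?_
    rcases h with h | h
    · exact measureReal_mul_le_measureReal_inter_of_isUpperSet h.1 (isUpperSet_iInter₂ h.2)
    · exact measureReal_mul_le_measureReal_inter_of_isLowerSet h.1 (isLowerSet_iInter₂ h.2)

end Harris

section Concentration

variable {Ω ι : Type*} {mΩ : MeasurableSpace Ω} {μ : Measure Ω} [IsProbabilityMeasure μ]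

theorem covariance_le_one {X Y : Ω → ℝ} (hX : MemLp X 2 μ) (hY : MemLp Y 2 μ)
    (hX₀₁ : ∀ ω, X ω ∈ Set.Icc 0 1) (hY₀₁ : ∀ ω, Y ω ∈ Set.Icc 0 1) : cov[X, Y; μ] ≤ 1 := by
  have hXY : μ[X * Y] ≤ 1 := by
    simpa using integral_mono (hX.integrable_mul hY) (integrable_const 1) fun ω =>
      mul_le_one₀ (hX₀₁ ω).2 (hY₀₁ ω).1 (hY₀₁ ω).2
  have hnonneg : 0 ≤ μ[X] * μ[Y] :=
    mul_nonneg (integral_nonneg fun ω => (hX₀₁ ω).1) (integral_nonneg fun ω => (hY₀₁ ω).1)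
  rw [covariance_eq_sub hX hY]
  linarith

open Classical in
theorem variance_sum_le_card_mul {X : ι → Ω → ℝ} {s : Finset ι}
    (hX : ∀ i ∈ s, Measurable (X i)) (hX₀₁ : ∀ i ∈ s, ∀ ω, X i ω ∈ Set.Icc 0 1) {M : ℕ}
    (hM : ∀ i ∈ s, {j ∈ s | ¬ IndepFun (X i) (X j) μ}.card ≤ M) :
    Var[∑ i ∈ s, X i; μ] ≤ s.card * M := by
  have hL2 (i) (hi : i ∈ s) : MemLp (X i) 2 μ :=
    memLp_of_bounded (.of_forall (hX₀₁ i hi)) (hX i hi).aestronglyMeasurable 2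
  rw [variance_sum' hL2]
  calc ∑ i ∈ s, ∑ j ∈ s, cov[X i, X j; μ]
      = ∑ i ∈ s, ∑ j ∈ s with ¬ IndepFun (X i) (X j) μ, cov[X i, X j; μ] := by
        refine Finset.sum_congr rfl fun i hi => Eq.symm ?_
        refine Finset.sum_filter_of_ne fun j hj hne hind => hne ?_
        exact hind.covariance_eq_zero (hL2 i hi) (hL2 j hj)
    _ ≤ ∑ _i ∈ s, (M : ℝ) := by
        refine Finset.sum_le_sum fun i hi => ?_
        have hcov : ∀ j ∈ s.filter fun j => ¬ IndepFun (X i) (X j) μ, cov[X i, X j; μ] ≤ 1 :=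
          fun j hj => have hj := Finset.mem_of_mem_filter j hj
            covariance_le_one (hL2 i hi) (hL2 j hj) (hX₀₁ i hi) (hX₀₁ j hj)
        refine (Finset.sum_le_card_nsmul _ _ 1 hcov).trans ?_
        rw [nsmul_one]
        exact_mod_cast hM i hi
    _ = s.card * M := by rw [Finset.sum_const, nsmul_eq_mul]

theorem exists_sum_sub_integral_sq_le {Z : ι → Ω → ℝ} {s : Finset ι}
    (hZ : ∀ i ∈ s, MemLp (Z i) 2 μ) :
    ∃ ω, ∑ i ∈ s, (Z i ω - ∫ ω', Z i ω' ∂μ) ^ 2 ≤ ∑ i ∈ s, Var[Z i; μ] := by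
  have hZint (i) (hi : i ∈ s) : Integrable (fun ω => (Z i ω - ∫ ω', Z i ω' ∂μ) ^ 2) μ :=
    ((hZ i hi).sub (memLp_const _)).integrable_sq
  obtain ⟨ω, hω⟩ := exists_le_integral (integrable_finsetSum s hZint)
  refine ⟨ω, hω.trans_eq ?_⟩
  rw [integral_finsetSum s hZint]
  exact Finset.sum_congr rfl fun i hi => (variance_eq_integral (hZ i hi).aemeasurable).symm

end Concentration

/-! ### The random kernel -/

section Selection

open Relation

variable {W : Type*} {E : Digraph W} {r : W → ℕ}

/-- The kernel of the subdigraph of `E` induced on `A`: a vertex of `A` is in the kernel if none of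
its out-neighbours is. The rank function `r` makes the recursion well-founded. -/
def InKernel (hr : ∀ x y, E.Adj x y → r y < r x) (A : Set W) (x : W) : Prop :=
  x ∈ A ∧ ∀ y, (_ : E.Adj x y) → ¬ InKernel hr A y
termination_by r x
decreasing_by exact hr _ _ ‹_›

variable (hr : ∀ x y, E.Adj x y → r y < r x)

theorem inKernel_iff {A : Set W} {x : W} :
    InKernel hr A x ↔ x ∈ A ∧ ∀ y, E.Adj x y → ¬ InKernel hr A y := by
  rw [InKernel]

include hr in
theorem lt_of_transGen {x z : W} (h : TransGen E.Adj x z) : r z < r x := by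
  induction h with
  | single h => exact hr _ _ h
  | tail _ h ih => exact (hr _ _ h).trans ih

theorem inKernel_congr {A B : Set W} {x : W} (h : ∀ z, ReflTransGen E.Adj x z → (z ∈ A ↔ z ∈ B)) :
    InKernel hr A x ↔ InKernel hr B x := by
  induction x using (measure r).wf.induction with
  | h x ih =>
    rw [inKernel_iff, inKernel_iff, h x .refl]
    refine and_congr_right fun _ => forall₂_congr fun y hxy => not_congr ?_
    exact ih y (hr x y hxy) fun z hz => h z (hz.head hxy)

/-- The set of coin outcomes for which `x` is selected, where the coin of `z` puts `z` at disposal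
if it shows the colour `c z` and the selected vertices are the kernel of the disposable ones. When
`c` is a proper `2`-colouring, this choice of sides makes the events monotone. -/
def selectionEvent (c : W → Bool) (x : W) : Set (W → Bool) :=
  {ζ | InKernel hr {z | ζ z = c z} x}

/-- The event that no out-neighbour of `x` is selected. -/
def freeEvent (c : W → Bool) (x : W) : Set (W → Bool) :=
  ⋂ y ∈ {y | E.Adj x y}, (selectionEvent hr c y)ᶜ

theorem selectionEvent_eq_inter (c : W → Bool) (x : W) :
    selectionEvent hr c x = {ζ | ζ x = c x} ∩ freeEvent hr c x := by
  ext ζ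
  simp only [selectionEvent, freeEvent, Set.mem_ofPred_eq, Set.mem_inter_iff, Set.mem_iInter,
    Set.mem_compl_iff]
  exact inKernel_iff hr

theorem dependsOn_selectionEvent (c : W → Bool) (x : W) :
    DependsOn (· ∈ selectionEvent hr c x) {z | ReflTransGen E.Adj x z} :=
  fun ζ ζ' h => propext <| inKernel_congr hr fun z hz => by
    simp only [Set.mem_ofPred_eq, h z hz]

theorem dependsOn_freeEvent (c : W → Bool) (x : W) :
    DependsOn (· ∈ freeEvent hr c x) {z | TransGen E.Adj x z} := by
  intro ζ ζ' h
  simp only [freeEvent, Set.mem_iInter, Set.mem_compl_iff]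
  refine propext <| forall₂_congr fun y hxy => not_congr <| iff_of_eq ?_
  exact dependsOn_selectionEvent hr c y fun z hz => h z (.head' hxy hz)

theorem isUpperSet_or_isLowerSet_selectionEvent {c : W → Bool}
    (hc : ∀ x y, E.Adj x y → c x ≠ c y) (x : W) :
    (c x = true → IsUpperSet (selectionEvent hr c x)) ∧
      (c x = false → IsLowerSet (selectionEvent hr c x)) := by
  induction x using (measure r).wf.induction with
  | h x ih =>
    have hfree : (c x = true → IsUpperSet (freeEvent hr c x)) ∧
        (c x = false → IsLowerSet (freeEvent hr c x)) :=
      ⟨fun hx => isUpperSet_iInter₂ fun y hxy =>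
        ((ih y (hr x y hxy)).2 (by simpa [hx] using (hc x y hxy).symm)).compl,
      fun hx => isLowerSet_iInter₂ fun y hxy =>
        ((ih y (hr x y hxy)).1 (by simpa [hx] using (hc x y hxy).symm)).compl⟩
    rw [selectionEvent_eq_inter]
    refine ⟨fun hx => .inter (fun ζ ζ' hle hζ => ?_) (hfree.1 hx),
      fun hx => .inter (fun ζ ζ' hle hζ => ?_) (hfree.2 hx)⟩
    · exact (top_le_iff.1 <| hx.ge.trans <| hζ.ge.trans (hle x)).trans hx.symm
    · exact (le_bot_iff.1 <| (hle x).trans <| hζ.le.trans hx.le).trans hx.symm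

/-- The law of independent coins, the one of `x` showing `c x` with probability `p x`. -/
noncomputable def coinMeasure [Fintype W] (c : W → Bool) (p : W → unitInterval) :
    Measure (W → Bool) :=
  Measure.pi fun x => bernoulliMeasure (c x) (!c x) (p x)

instance [Fintype W] (c : W → Bool) (p : W → unitInterval) :
    IsProbabilityMeasure (coinMeasure c p) :=
  inferInstanceAs (IsProbabilityMeasure (Measure.pi _))

variable [Fintype W] {c : W → Bool} {p : W → unitInterval}

theorem coinMeasure_real_eq (x : W) : (coinMeasure c p).real {ζ | ζ x = c x} = p x := by
  have h := (measurePreserving_eval (fun x => bernoulliMeasure (c x) (!c x) (p x))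
    x).measureReal_preimage (MeasurableSet.singleton (c x)).nullMeasurableSet
  refine h.trans ?_
  rw [bernoulliMeasure_real_apply_of_mem_of_notMem] <;> simp

theorem coinMeasure_real_congr {p' : W → unitInterval} {A : Set (W → Bool)} {S : Set W}
    (hA : DependsOn (· ∈ A) S) (h : ∀ x ∈ S, p x = p' x) :
    (coinMeasure c p).real A = (coinMeasure c p').real A :=
  congrArg ENNReal.toReal <| pi_apply_eq_of_dependsOn .of_discrete hA fun x hx => by rw [h x hx]

theorem coinMeasure_real_selectionEvent (x : W) :
    (coinMeasure c p).real (selectionEvent hr c x) =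
      p x * (coinMeasure c p).real (freeEvent hr c x) := by
  have hcoin : DependsOn (fun ζ : W → Bool => ζ x) {x} := fun _ _ h => h x rfl
  have hdisj : Disjoint {x} {z | TransGen E.Adj x z} :=
    Set.disjoint_singleton_left.2 fun h => (lt_of_transGen hr h).false
  have hind : IndepFun (fun ζ : W → Bool => ζ x) (· ∈ freeEvent hr c x) (coinMeasure c p) :=
    indepFun_pi_of_dependsOn .of_discrete .of_discrete hcoin (dependsOn_freeEvent hr c x) hdisj
  rw [← coinMeasure_real_eq, selectionEvent_eq_inter, measureReal_def, measureReal_def,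
    measureReal_def, ← ENNReal.toReal_mul]
  simpa [Set.preimage] using congrArg ENNReal.toReal
    (hind.measure_inter_preimage_eq_mul {c x} {True} .of_discrete .of_discrete)

theorem one_sub_pow_le_coinMeasure_real_freeEvent (hc : ∀ x y, E.Adj x y → c x ≠ c y) {x : W}
    {d : ℕ} (hd : {y | E.Adj x y}.encard ≤ d) {η : ℝ} (hη₀ : 0 ≤ η) (hη₁ : η ≤ 1)
    (h : ∀ y, E.Adj x y → (coinMeasure c p).real (selectionEvent hr c y) = η) :
    (1 - η) ^ d ≤ (coinMeasure c p).real (freeEvent hr c x) := by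
  obtain ⟨s, hs⟩ := {y | E.Adj x y}.toFinite.exists_finset_coe
  have hadj {y : W} : y ∈ s ↔ E.Adj x y := Set.ext_iff.1 hs y
  have hmono : (∀ y ∈ s, IsUpperSet (selectionEvent hr c y)ᶜ) ∨
      ∀ y ∈ s, IsLowerSet (selectionEvent hr c y)ᶜ := by
    have hsel := isUpperSet_or_isLowerSet_selectionEvent hr hc
    cases hx : c x
    · exact .inr fun y hy => ((hsel y).1 (by simpa [hx] using hc x y (hadj.1 hy))).compl
    · exact .inl fun y hy => ((hsel y).2 (by simpa [hx] using hc x y (hadj.1 hy))).compl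
  rw [← hs, Set.encard_coe_eq_coe_finsetCard, Nat.cast_le] at hd
  calc (1 - η) ^ d ≤ (1 - η) ^ s.card :=
        pow_le_pow_of_le_one (sub_nonneg.2 hη₁) (sub_le_self 1 hη₀) hd
    _ = ∏ y ∈ s, (coinMeasure c p).real (selectionEvent hr c y)ᶜ := by
        rw [← Finset.prod_const]
        refine Finset.prod_congr rfl fun y hy => ?_
        rw [probReal_compl_eq_one_sub .of_discrete, h y (hadj.1 hy)]
    _ ≤ (coinMeasure c p).real (⋂ y ∈ s, (selectionEvent hr c y)ᶜ) :=
        prod_measureReal_le_measureReal_biInter s hmono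
    _ = (coinMeasure c p).real (freeEvent hr c x) := by
        rw [freeEvent, ← hs]
        rfl

theorem exists_coinMeasure_real_selectionEvent_eq (hc : ∀ x y, E.Adj x y → c x ≠ c y) {d : ℕ}
    (hd : ∀ x, {y | E.Adj x y}.encard ≤ d) {η : ℝ} (hη₀ : 0 < η) (hη₁ : η ≤ 1)
    (hη : η ≤ (1 - η) ^ d) :
    ∃ p, ∀ x, (coinMeasure c p).real (selectionEvent hr c x) = η := by
  suffices ∀ n, ∃ p, ∀ x, r x < n → (coinMeasure c p).real (selectionEvent hr c x) = η by
    obtain ⟨n, hn⟩ := (Set.finite_range r).bddAbove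
    exact (this (n + 1)).imp fun p hp x => hp x (Nat.lt_succ_of_le (hn ⟨x, rfl⟩))
  intro n
  induction n with
  | zero => exact ⟨fun _ => 0, fun x hx => absurd hx (Nat.not_lt_zero _)⟩
  | succ n ih =>
    obtain ⟨p, hp⟩ := ih
    let q (x : W) : ℝ := η / (coinMeasure c p).real (freeEvent hr c x)
    let p' (x : W) := if r x = n then Set.projIcc 0 1 zero_le_one (q x) else p x
    have hpp' (x) (hx : r x < n) : p' x = p x := if_neg hx.ne
    refine ⟨p', fun x hx => ?_⟩
    rcases Nat.lt_succ_iff_lt_or_eq.1 hx with hlt | heq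
    · rw [← hp x hlt]
      refine coinMeasure_real_congr (dependsOn_selectionEvent hr c x) fun z hz => hpp' z ?_
      rcases reflTransGen_iff_eq_or_transGen.1 hz with rfl | hz
      exacts [hlt, (lt_of_transGen hr hz).trans hlt]
    · have hle : η ≤ (coinMeasure c p).real (freeEvent hr c x) :=
        hη.trans <| one_sub_pow_le_coinMeasure_real_freeEvent hr hc (hd x) hη₀.le hη₁ fun y hxy =>
          hp y (heq ▸ hr x y hxy)
      have hfree : (coinMeasure c p').real (freeEvent hr c x) =
          (coinMeasure c p).real (freeEvent hr c x) :=
        coinMeasure_real_congr (dependsOn_freeEvent hr c x) fun z hz =>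
          hpp' z (heq ▸ lt_of_transGen hr hz)
      have hq : q x ∈ Set.Icc 0 1 := ⟨by positivity, div_le_one_of_le₀ hle measureReal_nonneg⟩
      rw [coinMeasure_real_selectionEvent, hfree]
      simp only [p', if_pos heq, Set.projIcc_of_mem _ hq, q]
      exact div_mul_cancel₀ η (hη₀.trans_le hle).ne'

end Selection

section Dependence

open Relation

variable {W : Type*} {K : SimpleGraph W}

theorem exists_adj_edist_le {x y : W} {n : ℕ} (hxy : x ≠ y) (h : K.edist x y ≤ (n + 1 : ℕ)) :
    ∃ z, K.Adj x z ∧ K.edist z y ≤ n := by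
  obtain ⟨w, hw⟩ :=
    SimpleGraph.exists_walk_of_edist_ne_top (ne_top_of_le_ne_top (ENat.natCast_ne_top _) h)
  cases w with
  | nil => exact absurd rfl hxy
  | cons hadj w =>
    refine ⟨_, hadj, w.edist_le.trans ?_⟩
    rw [← hw, SimpleGraph.Walk.length_cons, Nat.cast_le] at h
    exact_mod_cast Nat.le_of_succ_le_succ h

open Classical in
theorem card_filter_edist_le [Fintype W] {Δ : ℕ} (hΔ : ∀ x, K.degree x ≤ Δ) (n : ℕ) (x : W) :
    (Finset.univ.filter fun y => K.edist x y ≤ n).card ≤ (Δ + 1) ^ n := by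
  induction n generalizing x with
  | zero => simp [Finset.filter_eq]
  | succ n ih =>
    have hsub : (Finset.univ.filter fun y => K.edist x y ≤ (n + 1 : ℕ)) ⊆
        (insert x (K.neighborFinset x)).biUnion fun z =>
          Finset.univ.filter fun y => K.edist z y ≤ n := by
      intro y hy
      simp only [Finset.mem_biUnion, Finset.mem_filter_univ] at hy ⊢
      rcases eq_or_ne x y with rfl | hxy
      · exact ⟨x, Finset.mem_insert_self _ _, by simp⟩
      · obtain ⟨z, hz, hzy⟩ := exists_adj_edist_le hxy hy
        exact ⟨z, Finset.mem_insert_of_mem ((K.mem_neighborFinset _ _).2 hz), hzy⟩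
    rw [pow_succ']
    refine (Finset.card_le_card hsub).trans <|
      (Finset.card_biUnion_le_card_mul _ _ _ fun z _ => ih z).trans ?_
    gcongr
    exact (Finset.card_insert_le _ _).trans (Nat.succ_le_succ (hΔ x))

variable {E : Digraph W} {r : W → ℕ} (hr : ∀ x y, E.Adj x y → r y < r x)
  (hK : ∀ x y, E.Adj x y → K.Adj x y)

include hr hK in
theorem edist_le_of_reflTransGen {x z : W} (h : ReflTransGen E.Adj x z) : K.edist x z ≤ r x := by
  induction h using ReflTransGen.head_induction_on with
  | refl => simp
  | @head x y hxy _ ih =>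
    calc K.edist x z ≤ K.edist x y + K.edist y z := SimpleGraph.edist_triangle
      _ ≤ 1 + r y := add_le_add (SimpleGraph.edist_eq_one_iff_adj.2 (hK x y hxy)).le ih
      _ ≤ r x := by rw [add_comm]; exact_mod_cast hr x y hxy

variable [Fintype W] {c : W → Bool} {p : W → unitInterval}

include hK in
theorem indepFun_indicator_selectionEvent {n : ℕ} (hn : ∀ x, r x ≤ n) {x y : W}
    (hxy : ¬ K.edist x y ≤ (2 * n : ℕ)) :
    IndepFun ((selectionEvent hr c x).indicator (1 : (W → Bool) → ℝ))
      ((selectionEvent hr c y).indicator (1 : (W → Bool) → ℝ)) (coinMeasure c p) := by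
  classical
  have hdep (x : W) : DependsOn ((selectionEvent hr c x).indicator (1 : (W → Bool) → ℝ))
      {z | ReflTransGen E.Adj x z} := fun ζ ζ' h => by
    simp only [Set.indicator_apply, Pi.one_apply, dependsOn_selectionEvent hr c x h]
  refine indepFun_pi_of_dependsOn .of_discrete .of_discrete (hdep x) (hdep y) ?_
  refine Set.disjoint_left.2 fun z hxz hyz => hxy ?_
  have hle {x : W} (h : ReflTransGen E.Adj x z) : K.edist x z ≤ n :=
    (edist_le_of_reflTransGen hr hK h).trans (Nat.cast_le.2 (hn x))
  calc K.edist x y ≤ K.edist x z + K.edist z y := SimpleGraph.edist_triangle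
    _ ≤ n + n := add_le_add (hle hxz) (SimpleGraph.edist_comm ▸ hle hyz)
    _ = (2 * n : ℕ) := by rw [two_mul]; norm_cast

open Classical in
include hK in
theorem exists_sum_card_inKernel_sub_sq_le (hc : ∀ x y, E.Adj x y → c x ≠ c y) {d : ℕ}
    (hd : ∀ x, {y | E.Adj x y}.encard ≤ d) {η : ℝ} (hη₀ : 0 < η) (hη₁ : η ≤ 1)
    (hη : η ≤ (1 - η) ^ d) {n Δ : ℕ} (hn : ∀ x, r x ≤ n) (hΔ : ∀ x, K.degree x ≤ Δ)
    {V : Type*} (s : Finset V) (L : V → Finset W) :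
    ∃ A : Set W, ∑ u ∈ s, (((L u).filter (InKernel hr A)).card - η * (L u).card : ℝ) ^ 2 ≤
      ∑ u ∈ s, ((L u).card * ((Δ + 1) ^ (2 * n) : ℕ) : ℝ) := by
  obtain ⟨p, hp⟩ := exists_coinMeasure_real_selectionEvent_eq hr hc hd hη₀ hη₁ hη
  let X (x : W) : (W → Bool) → ℝ := (selectionEvent hr c x).indicator 1
  have hX₀₁ (x ζ) : X x ζ ∈ Set.Icc 0 1 :=
    ⟨Set.indicator_nonneg (fun _ _ => zero_le_one) ζ,
      Set.indicator_le_self' (fun _ _ => zero_le_one) ζ⟩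
  have hX₂ (x) : MemLp (X x) 2 (coinMeasure c p) :=
    memLp_of_bounded (.of_forall (hX₀₁ x)) .of_discrete 2
  have hmean (u) : ∫ ζ, (∑ x ∈ L u, X x) ζ ∂coinMeasure c p = η * (L u).card := by
    simp only [Finset.sum_apply]
    rw [integral_finsetSum _ fun x _ => (hX₂ x).integrable one_le_two]
    simp only [X, integral_indicator_one .of_discrete, hp, Finset.sum_const, nsmul_eq_mul, mul_comm]
  have hvar (u) : Var[∑ x ∈ L u, X x; coinMeasure c p] ≤
      (L u).card * ((Δ + 1) ^ (2 * n) : ℕ) := by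
    refine variance_sum_le_card_mul (fun x _ => .of_discrete) (fun x _ => hX₀₁ x) fun x _ => ?_
    refine (Finset.card_le_card fun y hy => ?_).trans (card_filter_edist_le hΔ (2 * n) x)
    rw [Finset.mem_filter_univ]
    by_contra hfar
    exact (Finset.mem_filter.1 hy).2 (indepFun_indicator_selectionEvent hr hK hn hfar)
  obtain ⟨ζ, hζ⟩ := exists_sum_sub_integral_sq_le (s := s) (μ := coinMeasure c p)
    fun u _ => memLp_finsetSum' (L u) fun x _ => hX₂ x
  refine ⟨{z | ζ z = c z}, le_trans (le_of_eq ?_) (hζ.trans (Finset.sum_le_sum fun u _ => hvar u))⟩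
  refine Finset.sum_congr rfl fun u _ => ?_
  rw [hmean, Finset.sum_apply, Finset.card_filter, Nat.cast_sum]
  simp only [X, Set.indicator_apply, selectionEvent, Set.mem_ofPred_eq, Pi.one_apply,
    Nat.cast_ite, Nat.cast_one, Nat.cast_zero]

end Dependence

/-! ### Colorings of degenerate bipartite graphs -/

theorem exists_rank_of_acyclic {V : Type*} [Finite V] {D : Digraph V} (hD : IsAcyclicDigraph D) :
    ∃ r : V → ℕ, (∀ u v, D.Adj u v → r v < r u) ∧ ∀ u, r u ≤ Nat.card V := by
  refine ⟨fun u => {v | Relation.TransGen D.Adj u v}.ncard, fun u v h => ?_, fun u => ?_⟩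
  · refine Set.ncard_lt_ncard ⟨fun w hw => .head h hw, fun hsub => ?_⟩
    exact hD v (hsub (.single h))
  · rw [← Set.ncard_univ]
    exact Set.ncard_le_ncard (Set.subset_univ _)

namespace Cover

variable {V W : Type u} {G : SimpleGraph V} {D : Digraph V} (C : Cover G W)

/-- The vertex of `G` in whose list `x` lies. -/
noncomputable def proj (x : W) : V := (C.partition x).choose

theorem mem_L_proj (x : W) : x ∈ C.L (C.proj x) := (C.partition x).choose_spec.1

variable {C} in
theorem proj_eq_of_mem {x : W} {u : V} (h : x ∈ C.L u) : C.proj x = u :=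
  ((C.partition x).choose_spec.2 u h).symm

theorem finite_of_finite [Finite V] (C : Cover G W) : Finite W := by
  refine Set.finite_univ_iff.1 ((Set.finite_iUnion fun u => (C.L u).finite_toSet).subset ?_)
  exact fun x _ => Set.mem_iUnion.2 ⟨_, C.mem_L_proj x⟩

/-- The graph of the cross-edges of a cover, that is, of its edges between different lists. -/
def crossGraph : SimpleGraph W where
  Adj x y := C.H.Adj x y ∧ C.proj x ≠ C.proj y
  symm := ⟨fun _ _ h => ⟨h.1.symm, h.2.symm⟩⟩
  loopless := ⟨fun _ h => h.2 rfl⟩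

/-- The orientation of the cross-edges of a cover of `G` induced by an orientation `D` of `G`. -/
def orient (D : Digraph V) : Digraph W where
  Adj x y := C.H.Adj x y ∧ D.Adj (C.proj x) (C.proj y)

variable {C}

theorem adj_proj_of_crossGraph_adj {x y : W} (h : C.crossGraph.Adj x y) :
    G.Adj (C.proj x) (C.proj y) :=
  (C.edge _ _ x (C.mem_L_proj x) y (C.mem_L_proj y) h.1).resolve_left h.2

theorem injOn_proj_neighborSet_crossGraph (x : W) :
    Set.InjOn C.proj (C.crossGraph.neighborSet x) := fun y hy z hz hyz =>
  C.matching _ _ (adj_proj_of_crossGraph_adj hy) x (C.mem_L_proj x) y (C.mem_L_proj y) z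
    (hyz ▸ C.mem_L_proj z) hy.1 hz.1

theorem quasiIndependent_of_forall_not_crossGraph_adj {S : Set W}
    (h : ∀ x ∈ S, ∀ y ∈ S, ¬ C.crossGraph.Adj x y) : C.QuasiIndependent S := by
  intro u v huv x hx y hy hxu hyv hxy
  obtain rfl := proj_eq_of_mem hxu
  obtain rfl := proj_eq_of_mem hyv
  exact h x hx y hy ⟨hxy, huv⟩

theorem crossGraph_adj_of_orient_adj (hD : IsOrientation G D) {x y : W}
    (h : (C.orient D).Adj x y) : C.crossGraph.Adj x y :=
  ⟨h.1, ((hD.1 _ _).2 (.inl h.2)).ne⟩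

theorem quasiIndependent_inKernel_orient (hD : IsOrientation G D) {r : W → ℕ}
    (hr : ∀ x y, (C.orient D).Adj x y → r y < r x) (A : Set W) :
    C.QuasiIndependent {x | InKernel hr A x} := by
  refine quasiIndependent_of_forall_not_crossGraph_adj fun x hx y hy hxy => ?_
  rcases (hD.1 _ _).1 (adj_proj_of_crossGraph_adj hxy) with h | h
  · exact ((inKernel_iff hr).1 hx).2 y ⟨hxy.1, h⟩ hy
  · exact ((inKernel_iff hr).1 hy).2 x ⟨hxy.1.symm, h⟩ hx

theorem encard_orient_adj_le (hD : IsOrientation G D) (x : W) :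
    {y | (C.orient D).Adj x y}.encard ≤ {v | D.Adj (C.proj x) v}.encard :=
  Set.encard_le_encard_of_injOn (fun _ hy => hy.2) <|
    (injOn_proj_neighborSet_crossGraph x).mono fun _ hy => crossGraph_adj_of_orient_adj hD hy

theorem degree_crossGraph_le [Finite V] (x : W) [Fintype (C.crossGraph.neighborSet x)] :
    C.crossGraph.degree x ≤ Nat.card V := by
  rw [← SimpleGraph.card_neighborSet_eq_degree, ← Nat.card_eq_fintype_card]
  exact Nat.card_le_card_of_injective _ (injOn_proj_neighborSet_crossGraph x).injective

open Classical in
theorem exists_quasiIndependent_sum_sub_sq_le [Fintype V] (C : Cover G W) (hG : G.IsBipartite)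
    {d : ℕ} (hd : IsDegenerate G d) {η : ℝ} (hη₀ : 0 < η) (hη₁ : η ≤ 1)
    (hη : η ≤ (1 - η) ^ d) :
    ∃ S : Set W, C.QuasiIndependent S ∧
      ∑ u, (((S ∩ C.L u).ncard : ℝ) - η * (C.L u).card) ^ 2 ≤
        ∑ u, ((C.L u).card * ((Nat.card V + 1) ^ (2 * Nat.card V) : ℕ) : ℝ) := by
  have := C.finite_of_finite
  have := Fintype.ofFinite W
  obtain ⟨D, hD, hacyc, hdeg⟩ := hd
  obtain ⟨r, hr, hrle⟩ := exists_rank_of_acyclic hacyc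
  let col : G.Coloring Bool := SimpleGraph.Colorable.toColoring hG (by simp)
  have hr' (x y) (h : (C.orient D).Adj x y) : r (C.proj y) < r (C.proj x) := hr _ _ h.2
  have hc (x y) (h : (C.orient D).Adj x y) : col (C.proj x) ≠ col (C.proj y) :=
    col.valid ((hD.1 _ _).2 (.inl h.2))
  obtain ⟨A, hA⟩ := exists_sum_card_inKernel_sub_sq_le (r := fun x => r (C.proj x)) hr'
    (fun x y => crossGraph_adj_of_orient_adj hD) hc
    (fun x => (encard_orient_adj_le hD x).trans (hdeg _)) hη₀ hη₁ hη (fun x => hrle _)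
    (fun x => degree_crossGraph_le x) Finset.univ C.L
  refine ⟨{x | InKernel hr' A x}, quasiIndependent_inKernel_orient hD hr' A, ?_⟩
  convert hA using 5 with u
  rw [← Set.ncard_coe_finset, Finset.coe_filter, Set.inter_comm]
  rfl

theorem exists_isFracColoring [Finite V] (hG : G.IsBipartite) {d : ℕ} (hd : IsDegenerate G d)
    {k : ℕ} (hk : C.IsFold k) {η η' : ℝ} (hη₀ : 0 < η) (hη₁ : η ≤ 1) (hη : η ≤ (1 - η) ^ d)
    (hη' : η' ≤ η)
    (hk' : (Nat.card V * (Nat.card V + 1) ^ (2 * Nat.card V) : ℕ) ≤ (η - η') ^ 2 * k) :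
    ∃ S : Set W, C.IsFracColoring η' S := by
  have := Fintype.ofFinite V
  obtain ⟨S, hS, hsum⟩ := C.exists_quasiIndependent_sum_sub_sq_le hG hd hη₀ hη₁ hη
  refine ⟨S, hS, fun u => ?_⟩
  have hdev : (((S ∩ C.L u).ncard : ℝ) - η * k) ^ 2 ≤ ((η - η') * k) ^ 2 := by
    calc (((S ∩ C.L u).ncard : ℝ) - η * k) ^ 2
        ≤ ∑ u, (((S ∩ C.L u).ncard : ℝ) - η * (C.L u).card) ^ 2 := by
          rw [← hk u]
          exact Finset.single_le_sum (f := fun u => (((S ∩ C.L u).ncard : ℝ) -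
            η * (C.L u).card) ^ 2) (fun _ _ => sq_nonneg _) (Finset.mem_univ u)
      _ ≤ k * (Nat.card V * (Nat.card V + 1) ^ (2 * Nat.card V) : ℕ) := by
          refine hsum.trans_eq ?_
          simp only [hk _, Finset.sum_const, Finset.card_univ, nsmul_eq_mul,
            Nat.card_eq_fintype_card]
          push_cast
          ring
      _ ≤ k * ((η - η') ^ 2 * k) := by gcongr
      _ = ((η - η') * k) ^ 2 := by ring
  rw [hk u]
  linarith [(abs_le_of_sq_le_sq' hdev (mul_nonneg (sub_nonneg.2 hη') k.cast_nonneg)).1]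

end Cover

theorem le_thetaDP {V : Type u} {G : SimpleGraph V} {k : ℕ} {η : ℝ} (h₀ : 0 ≤ η) (h₁ : η ≤ 1)
    (h : ∀ (W : Type u) (C : Cover G W), C.IsFold k → ∃ S : Set W, C.IsFracColoring η S) :
    η ≤ thetaDP G k :=
  le_csSup ⟨1, fun _ h => h.2.1⟩ ⟨h₀, h₁, h⟩

theorem exists_le_thetaDP_of_isDegenerate {V : Type u} [Finite V] {G : SimpleGraph V}
    (hG : G.IsBipartite) {d : ℕ} (hd : IsDegenerate G d) {η η' : ℝ} (hη₀ : 0 < η) (hη₁ : η ≤ 1)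
    (hη : η ≤ (1 - η) ^ d) (hη'₀ : 0 ≤ η') (hη' : η' < η) : ∃ k ≥ 1, η' ≤ thetaDP G k := by
  have hpos : 0 < (η - η') ^ 2 := by
    have := sub_pos.2 hη'
    positivity
  obtain ⟨k, hk⟩ := exists_nat_ge
    ((Nat.card V * (Nat.card V + 1) ^ (2 * Nat.card V) : ℕ) / (η - η') ^ 2)
  have hk' : (Nat.card V * (Nat.card V + 1) ^ (2 * Nat.card V) : ℕ) ≤
      (η - η') ^ 2 * (k + 1 : ℕ) := by
    refine ((div_le_iff₀' hpos).1 hk).trans ?_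
    gcongr
    simp
  exact ⟨k + 1, k.succ_pos, le_thetaDP hη'₀ (hη'.le.trans hη₁) fun W C hC =>
    C.exists_isFracColoring hG hd hC hη₀ hη₁ hη hη'.le hk'⟩

theorem chiDP_le_of_isDegenerate {V : Type u} [Finite V] {G : SimpleGraph V}
    (hG : G.IsBipartite) {d : ℕ} (hd : IsDegenerate G d) {η : ℝ} (hη₀ : 0 < η) (hη₁ : η ≤ 1)
    (hη : η ≤ (1 - η) ^ d) : chiDP G ≤ (ENNReal.ofReal η)⁻¹ := by
  rw [ENNReal.le_inv_iff_le_inv]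
  refine le_of_forall_lt_imp_le_of_dense fun a ha => ?_
  have ha_top : a ≠ ∞ := ha.ne_top
  obtain ⟨k, hk, hθ⟩ := exists_le_thetaDP_of_isDegenerate hG hd hη₀ hη₁ hη
    ENNReal.toReal_nonneg ((ENNReal.lt_ofReal_iff_toReal_lt ha_top).1 ha)
  rw [← ENNReal.le_inv_iff_le_inv]
  refine (iInf₂_le k hk).trans (ENNReal.inv_le_inv.2 ?_)
  exact (ENNReal.le_ofReal_iff_toReal_le ha_top (ENNReal.toReal_nonneg.trans hθ)).2 hθ

theorem exists_eq_one_sub_pow (d : ℕ) (hd : d ≠ 0) :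
    ∃ η : ℝ, 0 < η ∧ η < 1 ∧ η = (1 - η) ^ d := by
  have hcont : ContinuousOn (fun x : ℝ => x - (1 - x) ^ d) (Set.Icc 0 1) := by fun_prop
  obtain ⟨η, ⟨h₀, h₁⟩, hroot : η - (1 - η) ^ d = 0⟩ := intermediate_value_Icc zero_le_one hcont
    (show (0 : ℝ) ∈ Set.Icc _ _ by simp [hd])
  refine ⟨η, h₀.lt_of_ne ?_, h₁.lt_of_ne ?_, sub_eq_zero.1 hroot⟩
  · rintro rfl
    norm_num at hroot
  · rintro rfl
    simp [hd] at hroot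

theorem le_of_le_one_sub_pow {d : ℕ} {x y : ℝ} (hx₁ : x ≤ 1) (hx : x ≤ (1 - x) ^ d)
    (hy : y = (1 - y) ^ d) : x ≤ y := by
  by_contra! hlt
  have : (1 - x) ^ d ≤ (1 - y) ^ d := pow_le_pow_left₀ (by linarith) (by linarith) d
  linarith

theorem neg_mul_one_add_le_log_one_sub {x ε : ℝ} (hx : 0 ≤ x) (hε : 0 ≤ ε)
    (hxε : x * (1 + ε) ≤ ε) : -(x * (1 + ε)) ≤ Real.log (1 - x) := by
  have hx₁ : x < 1 := by nlinarith
  have hinv : (1 - x)⁻¹ ≤ 1 + x * (1 + ε) := by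
    rw [inv_le_iff_one_le_mul₀ (by linarith)]
    nlinarith
  linarith [Real.one_sub_inv_le_log_of_pos (show 0 < 1 - x by linarith)]

theorem tendsto_log_div_natCast_atTop :
    Tendsto (fun d : ℕ => Real.log d / d) atTop (𝓝 0) :=
  Real.isLittleO_log_id_atTop.tendsto_div_nhds_zero.comp tendsto_natCast_atTop_atTop

theorem eventually_log_le_natCast_rpow {a : ℝ} (ha : 0 < a) :
    ∀ᶠ d : ℕ in atTop, Real.log d ≤ (d : ℝ) ^ a := by
  filter_upwards [((isLittleO_log_rpow_atTop ha).comp_tendsto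
    (tendsto_natCast_atTop_atTop (R := ℝ))).bound one_pos] with d hd
  rw [one_mul] at hd
  exact (le_abs_self _).trans (hd.trans_eq (abs_of_nonneg (Real.rpow_nonneg d.cast_nonneg a)))

theorem eventually_le_one_sub_pow {ε : ℝ} (hε₀ : 0 < ε) (hε₁ : ε < 1) :
    ∀ᶠ d : ℕ in atTop, (1 - ε) * (Real.log d / d) ≤ (1 - (1 - ε) * (Real.log d / d)) ^ d := by
  have hx : Tendsto (fun d : ℕ => (1 - ε) * (Real.log d / d) * (1 + ε)) atTop (𝓝 0) := by
    simpa using (tendsto_log_div_natCast_atTop.const_mul (1 - ε)).mul_const (1 + ε)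
  filter_upwards [hx.eventually_le_const hε₀,
    eventually_log_le_natCast_rpow (show 0 < ε ^ 2 by positivity), eventually_ge_atTop 2]
    with d hxd hlogd hd
  have hd₀ : (0 : ℝ) < d := by positivity
  have hlog : 0 < Real.log d := Real.log_pos (by exact_mod_cast hd)
  set x := (1 - ε) * (Real.log d / d) with hx_def
  have hx₀ : 0 < x := mul_pos (by linarith) (by positivity)
  have hx₁ : x < 1 := by nlinarith
  calc x ≤ Real.log d / d := mul_le_of_le_one_left (by positivity) (by linarith)
    _ ≤ (d : ℝ) ^ (ε ^ 2) / d := by gcongr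
    _ = Real.exp (Real.log d * ε ^ 2 - Real.log d) := by
        rw [Real.exp_sub, Real.exp_log hd₀, Real.rpow_def_of_pos hd₀]
    _ = Real.exp (d * -(x * (1 + ε))) := by
        congr 1
        rw [hx_def]
        field_simp
        ring
    _ ≤ Real.exp (d * Real.log (1 - x)) := by
        gcongr
        exact neg_mul_one_add_le_log_one_sub hx₀.le hε₀.le hxd
    _ = (1 - x) ^ d := by rw [Real.exp_nat_mul, Real.exp_log (by linarith)]

theorem eventually_le_of_eq_one_sub_pow {η : ℕ → ℝ} (hη : ∀ d ≠ 0, η d = (1 - η d) ^ d) {ε : ℝ}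
    (hε₀ : 0 < ε) (hε₁ : ε < 1) : ∀ᶠ d : ℕ in atTop, (1 - ε) * (Real.log d / d) ≤ η d := by
  filter_upwards [eventually_le_one_sub_pow hε₀ hε₁, eventually_ge_atTop 1] with d hle hd
  have hlog : Real.log d / d ≤ 1 := div_le_one_of_le₀ (Real.log_le_self d.cast_nonneg) d.cast_nonneg
  have hlog₀ : 0 ≤ Real.log d / d := div_nonneg (Real.log_natCast_nonneg d) d.cast_nonneg
  exact le_of_le_one_sub_pow (by nlinarith) hle (hη d (by omega))

theorem tendsto_max_log_div_mul_sub_one {η : ℕ → ℝ}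
    (hη : ∀ d ≠ 0, 0 < η d ∧ η d = (1 - η d) ^ d) :
    Tendsto (fun d : ℕ => max 0 (Real.log d / (d * η d) - 1)) atTop (𝓝 0) := by
  rw [Metric.tendsto_nhds]
  intro ε hε
  obtain ⟨τ, hτ₀, hτ⟩ := exists_between (show 0 < ε / (1 + ε) by positivity)
  have hτ₁ : τ < 1 := hτ.trans ((div_lt_one (by positivity)).2 (by linarith))
  filter_upwards [eventually_le_of_eq_one_sub_pow (fun d hd => (hη d hd).2) hτ₀ hτ₁,
    eventually_ge_atTop 2] with d hle hd
  have hd₀ : (0 : ℝ) < d := by positivity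
  have hlog : 0 < Real.log d := Real.log_pos (by exact_mod_cast hd)
  have hη₀ := (hη d (by omega)).1
  have hlower : (1 - τ) * Real.log d ≤ η d * d := by rwa [mul_div_assoc', div_le_iff₀ hd₀] at hle
  have hτε : 1 < (ε + 1) * (1 - τ) := by
    rw [lt_div_iff₀ (by positivity)] at hτ
    linarith
  rw [Real.dist_eq, sub_zero, abs_of_nonneg (le_max_left _ _), max_lt_iff, sub_lt_iff_lt_add,
    div_lt_iff₀ (by positivity)]
  refine ⟨hε, ?_⟩
  calc Real.log d < (ε + 1) * (1 - τ) * Real.log d := lt_mul_of_one_lt_left hlog hτε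
    _ = (ε + 1) * ((1 - τ) * Real.log d) := by ring
    _ ≤ (ε + 1) * (d * η d) := by rw [mul_comm (d : ℝ)]; gcongr

theorem exists_chiDP_le_of_isDegenerate :
    ∃ δ : ℕ → ℝ, Tendsto δ atTop (𝓝 0) ∧
      ∀ d : ℕ, 2 ≤ d → ∀ (V : Type u) [Finite V] (G : SimpleGraph V),
        G.IsBipartite → IsDegenerate G d →
          chiDP G ≤ ENNReal.ofReal ((1 + δ d) * ((d : ℝ) / Real.log (d : ℝ))) := by
  choose! η hη using exists_eq_one_sub_pow
  refine ⟨fun d => max 0 (Real.log d / (d * η d) - 1),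
    tendsto_max_log_div_mul_sub_one fun d hd => ⟨(hη d hd).1, (hη d hd).2.2⟩,
    fun d hd V _ G hG hdeg => ?_⟩
  obtain ⟨hη₀, hη₁, hroot⟩ := hη d (by omega)
  have hlog : 0 < Real.log d := Real.log_pos (by exact_mod_cast hd)
  refine (chiDP_le_of_isDegenerate hG hdeg hη₀ hη₁.le hroot.le).trans ?_
  rw [← ENNReal.ofReal_inv_of_pos hη₀]
  refine ENNReal.ofReal_le_ofReal ?_
  calc (η d)⁻¹ = (1 + (Real.log d / (d * η d) - 1)) * (d / Real.log d) := by field_simp; ring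
    _ ≤ _ := by gcongr; exact le_max_right _ _

/-! ### Random permutation covers -/

section Permutations

variable {α : Type*} [Fintype α] [DecidableEq α]

theorem card_perm_map_eq {S A B : Finset α} (hAB : A.card = B.card) :
    ({π | S.map π.toEmbedding = A} : Finset (Equiv.Perm α)).card =
      ({π | S.map π.toEmbedding = B} : Finset (Equiv.Perm α)).card := by
  obtain ⟨τ, rfl⟩ := Equiv.Perm.exists_map_finset_eq A B hAB
  refine Finset.card_equiv (Equiv.mulLeft τ) fun π => ?_
  have hmap : S.map (τ * π).toEmbedding = (S.map π.toEmbedding).map τ.toEmbedding := by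
    rw [Finset.map_map]
    rfl
  simp [hmap]

theorem card_perm_map_mem {S : Finset α} {𝒜 : Finset (Finset α)}
    (h𝒜 : ∀ A ∈ 𝒜, A.card = S.card) :
    ({π | S.map π.toEmbedding ∈ 𝒜} : Finset (Equiv.Perm α)).card =
      𝒜.card * ({π | S.map π.toEmbedding = S} : Finset (Equiv.Perm α)).card := by
  rw [Finset.card_eq_sum_card_fiberwise (f := fun π : Equiv.Perm α => S.map π.toEmbedding)
    (t := 𝒜) fun π hπ => by simpa using hπ]
  refine Finset.sum_const_nat fun A hA => ?_
  rw [← card_perm_map_eq (h𝒜 A hA), Finset.filter_filter]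
  congr 1
  exact Finset.filter_congr fun π _ => ⟨And.right, fun h => ⟨h ▸ hA, h⟩⟩

theorem card_perm_disjoint_map_mul_choose (S T : Finset α) :
    ({π | Disjoint (S.map π.toEmbedding) T} : Finset (Equiv.Perm α)).card *
        (Fintype.card α).choose S.card =
      (Fintype.card α).factorial * (Fintype.card α - T.card).choose S.card := by
  have hall : (Fintype.card α).factorial = _ :=
    Fintype.card_perm.symm.trans <| (congr_arg Finset.card (by ext; simp)).trans <|
      card_perm_map_mem (S := S) (𝒜 := Finset.powersetCard S.card Finset.univ)
        fun A hA => (Finset.mem_powersetCard.1 hA).2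
  have hdisj := card_perm_map_mem (S := S) (𝒜 := Finset.powersetCard S.card Tᶜ)
    fun A hA => (Finset.mem_powersetCard.1 hA).2
  simp only [Finset.mem_powersetCard, Finset.card_map, and_true,
    Finset.subset_compl_iff_disjoint_right] at hdisj
  rw [hall, hdisj]
  simp only [Finset.card_powersetCard, Finset.card_compl, Finset.card_univ]
  ring

end Permutations

theorem descFactorial_sub_mul_pow_le (k s t : ℕ) :
    (k - t).descFactorial s * k ^ s ≤ k.descFactorial s * (k - t) ^ s := by
  simp only [Nat.descFactorial_eq_prod_range, Finset.pow_eq_prod_const, ← Finset.prod_mul_distrib]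
  refine Finset.prod_le_prod' fun i _ => ?_
  rcases le_total (t + i) k with h | h
  · obtain ⟨l, rfl⟩ := Nat.exists_eq_add_of_le h
    rw [show t + i + l - t - i = l by omega, show t + i + l - i = t + l by omega,
      show t + i + l - t = i + l by omega]
    nlinarith
  · simp [show k - t - i = 0 by omega]

theorem choose_sub_mul_pow_le (k s t : ℕ) :
    (k - t).choose s * k ^ s ≤ k.choose s * (k - t) ^ s := by
  have h := descFactorial_sub_mul_pow_le k s t
  rw [Nat.descFactorial_eq_factorial_mul_choose, Nat.descFactorial_eq_factorial_mul_choose,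
    mul_assoc, mul_assoc] at h
  exact Nat.le_of_mul_le_mul_left h s.factorial_pos

theorem natCast_sub_pow_le {k t : ℕ} (hk : 0 < k) (htk : t ≤ k) (s : ℕ) :
    ((k - t : ℕ) : ℝ) ^ s ≤ Real.exp (-(s * t / k)) * k ^ s := by
  have hk₀ : (0 : ℝ) < k := by exact_mod_cast hk
  calc ((k - t : ℕ) : ℝ) ^ s = ((1 - t / k) * k) ^ s := by
        rw [Nat.cast_sub htk]
        field_simp
    _ ≤ (Real.exp (-(t / k)) * k) ^ s := by
        gcongr
        · exact mul_nonneg (sub_nonneg.2 (div_le_one_of_le₀ (by exact_mod_cast htk) hk₀.le)) hk₀.le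
        · exact Real.one_sub_le_exp_neg _
    _ = Real.exp (-(s * t / k)) * k ^ s := by
        rw [mul_pow, ← Real.exp_nat_mul]
        ring_nf

theorem choose_sub_le {k t : ℕ} (hk : 0 < k) (htk : t ≤ k) (s : ℕ) :
    ((k - t).choose s : ℝ) ≤ k.choose s * Real.exp (-(s * t / k)) := by
  refine le_of_mul_le_mul_right ?_ (show (0 : ℝ) < (k : ℝ) ^ s by positivity)
  calc ((k - t).choose s : ℝ) * k ^ s
      ≤ k.choose s * ((k - t : ℕ) : ℝ) ^ s := by exact_mod_cast choose_sub_mul_pow_le k s t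
    _ ≤ k.choose s * (Real.exp (-(s * t / k)) * k ^ s) := by
        gcongr
        exact natCast_sub_pow_le hk htk s
    _ = k.choose s * Real.exp (-(s * t / k)) * k ^ s := by ring

theorem card_perm_disjoint_map_le {α : Type*} [Fintype α] [DecidableEq α] [Nonempty α]
    (S T : Finset α) :
    (({π | Disjoint (S.map π.toEmbedding) T} : Finset (Equiv.Perm α)).card : ℝ) ≤
      (Fintype.card α).factorial * Real.exp (-(S.card * T.card / Fintype.card α)) := by
  have hchoose : (0 : ℝ) < (Fintype.card α).choose S.card := by
    exact_mod_cast Nat.choose_pos S.card_le_univ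
  refine le_of_mul_le_mul_right ?_ hchoose
  calc (_ : ℝ) = (Fintype.card α).factorial * (Fintype.card α - T.card).choose S.card := by
        exact_mod_cast card_perm_disjoint_map_mul_choose S T
    _ ≤ (Fintype.card α).factorial * ((Fintype.card α).choose S.card *
          Real.exp (-(S.card * T.card / Fintype.card α))) := by
        gcongr
        exact choose_sub_le Fintype.card_pos T.card_le_univ _
    _ = _ := by ring

theorem one_le_choose_pow_mul_exp_pow {ι κ α : Type*} [Fintype ι] [Fintype κ] [Fintype α]
    [Nonempty α] (s : ℕ) (f g : κ → ι)
    (h : ∀ σ : κ → Equiv.Perm α, ∃ T : ι → Finset α, (∀ i, (T i).card = s) ∧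
      ∀ e, Disjoint ((T (f e)).map (σ e).toEmbedding) (T (g e))) :
    (1 : ℝ) ≤ ((Fintype.card α).choose s) ^ Fintype.card ι *
      Real.exp (-(s ^ 2 / Fintype.card α)) ^ Fintype.card κ := by
  classical
  set k := Fintype.card α
  let families : Finset (ι → Finset α) :=
    Fintype.piFinset fun _ => Finset.powersetCard s Finset.univ
  let good (T : ι → Finset α) : Finset (κ → Equiv.Perm α) :=
    Fintype.piFinset fun e => {π | Disjoint ((T (f e)).map π.toEmbedding) (T (g e))}
  have hcover : Finset.univ ⊆ families.biUnion good := fun σ _ => by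
    obtain ⟨T, hT, hdisj⟩ := h σ
    exact Finset.mem_biUnion.2 ⟨T, by simp [families, hT], by simpa [good] using hdisj⟩
  have hgood : ∀ T ∈ families, ((good T).card : ℝ) ≤
      (k.factorial * Real.exp (-(s ^ 2 / k))) ^ Fintype.card κ := fun T hT => by
    have hT : ∀ i, (T i).card = s := by simpa [families] using hT
    rw [Fintype.card_piFinset, Nat.cast_prod, ← Finset.card_univ, ← Finset.prod_const]
    refine Finset.prod_le_prod (fun _ _ => Nat.cast_nonneg _) fun e _ => ?_
    refine (card_perm_disjoint_map_le _ _).trans_eq ?_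
    rw [hT, hT, sq]
  have hfamilies : families.card = k.choose s ^ Fintype.card ι := by
    simp [families, Fintype.card_piFinset, k]
  have hfact : (0 : ℝ) < (k.factorial : ℝ) ^ Fintype.card κ := by positivity
  refine le_of_mul_le_mul_left ?_ hfact
  calc (k.factorial : ℝ) ^ Fintype.card κ * 1
      = ((Finset.univ : Finset (κ → Equiv.Perm α)).card : ℝ) := by
        simp [Fintype.card_perm, k]
    _ ≤ ∑ T ∈ families, ((good T).card : ℝ) := by
        exact_mod_cast (Finset.card_le_card hcover).trans Finset.card_biUnion_le
    _ ≤ families.card • (k.factorial * Real.exp (-(s ^ 2 / k))) ^ Fintype.card κ :=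
        Finset.sum_le_card_nsmul _ _ _ hgood
    _ = _ := by
        rw [hfamilies, nsmul_eq_mul, Nat.cast_pow]
        ring

theorem choose_le_exp {k s : ℕ} (hs : 0 < s) (hk : 0 < k) :
    (k.choose s : ℝ) ≤ Real.exp (s * (1 - Real.log (s / k))) := by
  have hs₀ : (0 : ℝ) < s := by exact_mod_cast hs
  calc (k.choose s : ℝ) ≤ k ^ s / s.factorial := Nat.choose_le_pow_div s k
    _ = (s : ℝ) ^ s / s.factorial * ((s / k : ℝ) ^ s)⁻¹ := by
        rw [div_pow]
        field_simp
    _ ≤ Real.exp s * ((s / k : ℝ) ^ s)⁻¹ := by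
        gcongr
        exact Real.pow_div_factorial_le_exp s hs₀.le s
    _ = Real.exp (s * (1 - Real.log (s / k))) := by
        rw [mul_one_sub, Real.exp_sub, Real.exp_nat_mul, Real.exp_log (by positivity),
          ← div_eq_mul_inv]

theorem div_mul_le_of_one_le_choose_pow_mul_exp_pow {k s m n : ℕ} (hs : 0 < s) (hk : 0 < k)
    (h : (1 : ℝ) ≤ (k.choose s) ^ n * Real.exp (-(s ^ 2 / k)) ^ m) :
    (s / k : ℝ) * m ≤ n * (1 - Real.log (s / k)) := by
  have hexp : (1 : ℝ) ≤ Real.exp (n * (s * (1 - Real.log (s / k))) + m * -(s ^ 2 / k)) := by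
    rw [Real.exp_add, Real.exp_nat_mul _ n, Real.exp_nat_mul _ m]
    exact h.trans (by gcongr; exact choose_le_exp hs hk)
  refine le_of_mul_le_mul_left ?_ (show (0 : ℝ) < s by exact_mod_cast hs)
  calc (s : ℝ) * (s / k * m) = m * (s ^ 2 / k) := by ring
    _ ≤ n * (s * (1 - Real.log (s / k))) := by linarith [Real.one_le_exp_iff.1 hexp]
    _ = s * (n * (1 - Real.log (s / k))) := by ring

section PermCover

variable {a b k : ℕ}

/-- The graph on `(Fin a ⊕ Fin b) × Fin k` whose fibres over `Fin a ⊕ Fin b` are cliques, and in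
which the fibres over the two sides of `K_{a, b}` are matched by the permutations `σ`. -/
def permGraph (σ : Fin a × Fin b → Equiv.Perm (Fin k)) :
    SimpleGraph ((Fin a ⊕ Fin b) × Fin k) :=
  SimpleGraph.fromRel fun p q =>
    p.1 = q.1 ∨ ∃ i j, p.1 = Sum.inl i ∧ q.1 = Sum.inr j ∧ σ (i, j) p.2 = q.2

variable (σ : Fin a × Fin b → Equiv.Perm (Fin k))

theorem permGraph_adj_inl_inr {i : Fin a} {j : Fin b} {x y : Fin k} :
    (permGraph σ).Adj (Sum.inl i, x) (Sum.inr j, y) ↔ σ (i, j) x = y := by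
  simp [permGraph]

theorem permGraph_adj_inr_inl {i : Fin a} {j : Fin b} {x y : Fin k} :
    (permGraph σ).Adj (Sum.inr j, y) (Sum.inl i, x) ↔ σ (i, j) x = y := by
  simp [permGraph]

/-- The cover of `K_{a, b}` with lists of size `k` in which every edge is covered by the perfect
matching given by a permutation; the first-moment argument chooses the permutations at random. -/
def permCover : Cover (completeBipartiteGraph (Fin a) (Fin b)) ((Fin a ⊕ Fin b) × Fin k) where
  H := permGraph σ
  L u := {u} ×ˢ Finset.univ
  partition x := ⟨x.1, by simp, fun u hu =>
    (Finset.mem_singleton.1 (Finset.mem_product.1 hu).1).symm⟩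
  complete u := by
    rintro ⟨_, x⟩ hx ⟨_, y⟩ hy hxy
    simp_all [permGraph]
  edge u v := by
    rintro ⟨u', x⟩ hx ⟨v', y⟩ hy h
    obtain ⟨rfl, rfl⟩ : u' = u ∧ v' = v := by simp_all
    cases u' <;> cases v' <;> simp_all [permGraph, eq_comm]
  matching u v huv := by
    rintro ⟨u', x⟩ hx ⟨v', y⟩ hy ⟨w, z⟩ hz hxy hxz
    obtain ⟨rfl, rfl, rfl⟩ : u' = u ∧ v' = v ∧ w = v := by simp_all
    rcases u' with i | j <;> rcases w with i' | j'
    · simp at huv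
    · rw [permGraph_adj_inl_inr] at hxy hxz
      rw [← hxy, ← hxz]
    · rw [permGraph_adj_inr_inl] at hxy hxz
      rw [(σ (i', j)).injective (hxy.trans hxz.symm)]
    · simp at huv

theorem permCover_isFold : (permCover σ).IsFold k := fun u => by simp [permCover]

variable {σ}

theorem ncard_inter_permCover_L (S : Set ((Fin a ⊕ Fin b) × Fin k)) (u : Fin a ⊕ Fin b) :
    (S ∩ (permCover σ).L u).ncard = {x | (u, x) ∈ S}.ncard := by
  have himage : S ∩ (permCover σ).L u = Prod.mk u '' {x | (u, x) ∈ S} := by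
    ext ⟨v, x⟩
    simp only [permCover]
    aesop
  rw [himage, Set.ncard_image_of_injective _ (Prod.mk_right_injective u)]

theorem exists_disjoint_of_isFracColoring {η : ℝ} {S : Set ((Fin a ⊕ Fin b) × Fin k)}
    (hS : (permCover σ).IsFracColoring η S) :
    ∃ T : Fin a ⊕ Fin b → Finset (Fin k), (∀ u, (T u).card = ⌈η * k⌉₊) ∧
      ∀ e : Fin a × Fin b,
        Disjoint ((T (Sum.inl e.1)).map (σ e).toEmbedding) (T (Sum.inr e.2)) := by
  have hfibre : ∀ u, ∃ T : Finset (Fin k), (∀ x ∈ T, (u, x) ∈ S) ∧ T.card = ⌈η * k⌉₊ := by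
    intro u
    have hle := hS.2 u
    rw [permCover_isFold σ u, ncard_inter_permCover_L] at hle
    obtain ⟨T, hTS, hT⟩ := Set.exists_subset_card_eq (Nat.ceil_le.2 hle)
    have hfin := T.toFinite
    refine ⟨hfin.toFinset, fun x hx => hTS (hfin.mem_toFinset.1 hx), ?_⟩
    rw [← Set.ncard_eq_toFinset_card T hfin, hT]
  choose T hTS hT using hfibre
  refine ⟨T, hT, fun e => Finset.disjoint_left.2 fun y hy hy' => ?_⟩
  obtain ⟨x, hx, rfl⟩ := Finset.mem_map.1 hy
  exact hS.1 (Sum.inl e.1) (Sum.inr e.2) Sum.inl_ne_inr _ (hTS _ x hx) _ (hTS _ _ hy')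
    (by simp [permCover]) (by simp [permCover]) ((permGraph_adj_inl_inr σ).2 rfl)

theorem mul_le_of_forall_isFracColoring (hk : 0 < k) {η : ℝ} (hη : 0 < η)
    (h : ∀ σ : Fin a × Fin b → Equiv.Perm (Fin k), ∃ S, (permCover σ).IsFracColoring η S) :
    η * (a * b) ≤ (a + b) * (1 - Real.log η) := by
  have : NeZero k := ⟨hk.ne'⟩
  have hk₀ : (0 : ℝ) < k := by exact_mod_cast hk
  have hfirst := one_le_choose_pow_mul_exp_pow (ι := Fin a ⊕ Fin b) (κ := Fin a × Fin b)
    (α := Fin k) ⌈η * k⌉₊ (fun e => Sum.inl e.1) (fun e => Sum.inr e.2) fun σ =>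
      (h σ).elim fun _ hS => exists_disjoint_of_isFracColoring hS
  simp only [Fintype.card_fin, Fintype.card_sum, Fintype.card_prod] at hfirst
  have hceil := div_mul_le_of_one_le_choose_pow_mul_exp_pow
    (Nat.ceil_pos.2 (by positivity)) hk hfirst
  push_cast at hceil
  have hη_le : η ≤ ⌈η * k⌉₊ / k := (le_div_iff₀ hk₀).2 (Nat.le_ceil _)
  calc η * (a * b) ≤ (⌈η * k⌉₊ / k : ℝ) * (a * b) := by gcongr
    _ ≤ (a + b) * (1 - Real.log (⌈η * k⌉₊ / k)) := hceil
    _ ≤ (a + b) * (1 - Real.log η) := by gcongr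

end PermCover

theorem le_chiDP_completeBipartiteGraph {a b : ℕ} {η : ℝ} (hη : 0 < η)
    (h : (a + b) * (1 - Real.log η) < η * (a * b)) :
    (ENNReal.ofReal η)⁻¹ ≤ chiDP (completeBipartiteGraph (Fin a) (Fin b)) := by
  refine le_iInf₂ fun k hk => ENNReal.inv_le_inv.2 (ENNReal.ofReal_le_ofReal ?_)
  refine Real.sSup_le (fun η' hη' => ?_) hη.le
  by_contra! hlt
  have hfirst := mul_le_of_forall_isFracColoring (a := a) (b := b) hk (hη.trans hlt)
    fun σ => hη'.2.2 _ (permCover σ) (permCover_isFold σ)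
  refine absurd h (not_lt.2 ?_)
  calc η * (a * b : ℝ) ≤ η' * (a * b) := by gcongr
    _ ≤ (a + b) * (1 - Real.log η') := hfirst
    _ ≤ (a + b) * (1 - Real.log η) := by gcongr

theorem isBipartite_completeBipartiteGraph (α β : Type*) :
    (completeBipartiteGraph α β).IsBipartite := by
  simpa using (SimpleGraph.CompleteBipartiteGraph.bicoloring α β).colorable

theorem isDegenerate_completeBipartiteGraph (α β : Type*) [Fintype α] :
    IsDegenerate (completeBipartiteGraph α β) (Fintype.card α) := by
  let D : Digraph (α ⊕ β) := ⟨fun u v => u.isRight ∧ v.isLeft⟩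
  refine ⟨D, ⟨fun u v => ?_, fun u v h h' => ?_⟩, fun u hu => ?_, fun u => ?_⟩
  · cases u <;> cases v <;> simp [D]
  · cases u <;> simp_all [D]
  · obtain ⟨_, hout, -⟩ := Relation.TransGen.head'_iff.1 hu
    obtain ⟨_, -, hin⟩ := Relation.TransGen.tail'_iff.1 hu
    cases u <;> simp_all [D]
  · calc {v | D.Adj u v}.encard ≤ (Sum.inl '' (Set.univ : Set α)).encard :=
          Set.encard_le_encard fun v hv => by
            obtain ⟨i, rfl⟩ := Sum.isLeft_iff.1 hv.2
            exact ⟨i, trivial, rfl⟩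
      _ = Fintype.card α := by
          rw [Sum.inl_injective.encard_image, Set.encard_univ, ENat.card_eq_coe_fintype_card]

theorem eventually_add_mul_one_add_log_lt {ω : ℕ → ℕ}
    (hω : Tendsto (fun d : ℕ => (ω d : ℝ) / (d : ℝ)) atTop atTop) {c : ℝ} (hc : 1 < c) :
    ∀ᶠ d : ℕ in atTop, ((d : ℝ) + ω d) * (1 + Real.log d) < c * (ω d * Real.log d) := by
  have hlog : Tendsto (fun d : ℕ => Real.log d) atTop atTop :=
    Real.tendsto_log_atTop.comp tendsto_natCast_atTop_atTop
  have hlim : Tendsto (fun d : ℕ => (1 + ((ω d : ℝ) / d)⁻¹) * (1 + (Real.log d)⁻¹)) atTop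
      (𝓝 1) := by
    simpa using (hω.inv_tendsto_atTop.const_add 1).mul (hlog.inv_tendsto_atTop.const_add 1)
  filter_upwards [hlim.eventually_lt_const hc, hω.eventually_gt_atTop 0,
    hlog.eventually_gt_atTop 0, eventually_gt_atTop 0] with d hlt hratio hlog₀ hd
  have hd₀ : (0 : ℝ) < d := by exact_mod_cast hd
  have hω₀ : (0 : ℝ) < ω d := (div_pos_iff_of_pos_right hd₀).1 hratio
  calc ((d : ℝ) + ω d) * (1 + Real.log d)
      = (1 + ((ω d : ℝ) / d)⁻¹) * (1 + (Real.log d)⁻¹) * (ω d * Real.log d) := by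
        field_simp
        ring
    _ < c * (ω d * Real.log d) := by gcongr

theorem eventually_le_chiDP_completeBipartiteGraph {ω : ℕ → ℕ}
    (hω : Tendsto (fun d : ℕ => (ω d : ℝ) / (d : ℝ)) atTop atTop) {c : ℝ} (hc₀ : 0 < c)
    (hc₁ : c < 1) :
    ∀ᶠ d : ℕ in atTop, ENNReal.ofReal (c * (d / Real.log d)) ≤
      chiDP (completeBipartiteGraph (Fin d) (Fin (ω d))) := by
  filter_upwards [eventually_add_mul_one_add_log_lt hω ((one_lt_inv₀ hc₀).2 hc₁),
    (Real.tendsto_log_atTop.comp tendsto_natCast_atTop_atTop).eventually_ge_atTop 1,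
    eventually_gt_atTop 0] with d hlt (hlog₁ : 1 ≤ Real.log d) hd
  have hd₀ : (0 : ℝ) < d := by exact_mod_cast hd
  have hη : 0 < c⁻¹ * (Real.log d / d) := by positivity
  have hlogη : 1 - Real.log (c⁻¹ * (Real.log d / d)) ≤ 1 + Real.log d := by
    rw [Real.log_mul (by positivity) (by positivity), Real.log_div (by positivity) hd₀.ne']
    linarith [Real.log_nonneg hlog₁, Real.log_nonneg (one_le_inv₀ hc₀ |>.2 hc₁.le)]
  have hlower := le_chiDP_completeBipartiteGraph (a := d) (b := ω d) hη <|
    calc ((d : ℝ) + ω d) * (1 - Real.log (c⁻¹ * (Real.log d / d)))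
        ≤ (d + ω d) * (1 + Real.log d) := by gcongr
      _ < c⁻¹ * (ω d * Real.log d) := hlt
      _ = c⁻¹ * (Real.log d / d) * (d * ω d) := by field_simp
  rwa [← ENNReal.ofReal_inv_of_pos hη, mul_inv, inv_inv, inv_div] at hlower

theorem exists_eq_ofReal_one_add_mul {χ : ℕ → ℝ≥0∞} {x δ : ℕ → ℝ} (hx : ∀ d, 2 ≤ d → 0 < x d)
    (hδ : Tendsto δ atTop (𝓝 0)) (hupper : ∀ d, 2 ≤ d → χ d ≤ ENNReal.ofReal ((1 + δ d) * x d))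
    (hlower : ∀ c, 0 < c → c < 1 → ∀ᶠ d in atTop, ENNReal.ofReal (c * x d) ≤ χ d) :
    ∃ δ' : ℕ → ℝ, Tendsto δ' atTop (𝓝 0) ∧
      ∀ d, 2 ≤ d → χ d = ENNReal.ofReal ((1 + δ' d) * x d) := by
  have hfin (d) (hd : 2 ≤ d) : χ d ≠ ∞ := ((hupper d hd).trans_lt ENNReal.ofReal_lt_top).ne
  have hratio : Tendsto (fun d => (χ d).toReal / x d) atTop (𝓝 1) := by
    refine tendsto_order.2 ⟨fun a ha => ?_, fun a ha => ?_⟩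
    · obtain ⟨c, hac, hc₁⟩ := exists_between (max_lt ha one_pos)
      filter_upwards [hlower c ((le_max_right _ _).trans_lt hac) hc₁, eventually_ge_atTop 2]
        with d hle hd
      refine ((le_max_left _ _).trans_lt hac).trans_le ((le_div_iff₀ (hx d hd)).2 ?_)
      exact (ENNReal.ofReal_le_iff_le_toReal (hfin d hd)).1 hle
    · have hδ₁ : Tendsto (fun d => 1 + δ d) atTop (𝓝 1) := by simpa using hδ.const_add 1
      filter_upwards [hδ₁.eventually_const_lt one_pos, hδ₁.eventually_lt_const ha,
        eventually_ge_atTop 2] with d hpos hlt hd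
      refine lt_of_le_of_lt ((div_le_iff₀ (hx d hd)).2 ?_) hlt
      exact ENNReal.toReal_le_of_le_ofReal (mul_pos hpos (hx d hd)).le (hupper d hd)
  refine ⟨fun d => (χ d).toReal / x d - 1, by simpa using hratio.sub_const 1, fun d hd => ?_⟩
  rw [add_sub_cancel, div_mul_cancel₀ _ (hx d hd).ne', ENNReal.ofReal_toReal (hfin d hd)]

theorem exists_chiDP_completeBipartiteGraph_eq (ω : ℕ → ℕ)
    (hω : Tendsto (fun d : ℕ => (ω d : ℝ) / (d : ℝ)) atTop atTop) :
    ∃ δ : ℕ → ℝ, Tendsto δ atTop (𝓝 0) ∧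
      ∀ d : ℕ, 2 ≤ d → chiDP (completeBipartiteGraph (Fin d) (Fin (ω d))) =
        ENNReal.ofReal ((1 + δ d) * ((d : ℝ) / Real.log (d : ℝ))) := by
  obtain ⟨δ, hδ, hupper⟩ := exists_chiDP_le_of_isDegenerate.{0}
  refine exists_eq_ofReal_one_add_mul (fun d hd => ?_) hδ (fun d hd => ?_)
    fun c hc₀ hc₁ => eventually_le_chiDP_completeBipartiteGraph hω hc₀ hc₁
  · exact div_pos (by positivity) (Real.log_pos (by exact_mod_cast hd))
  · refine hupper d hd _ _ (isBipartite_completeBipartiteGraph _ _) ?_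
    simpa using isDegenerate_completeBipartiteGraph (Fin d) (Fin (ω d))

end FracDP

theorem corollary1p7 :
    (∃ δ : ℕ → ℝ, Tendsto δ atTop (𝓝 0) ∧
      ∀ d : ℕ, 2 ≤ d → ∀ (V : Type u) [Finite V] (G : SimpleGraph V),
        G.IsBipartite → FracDP.IsDegenerate G d →
          FracDP.chiDP G ≤ ENNReal.ofReal ((1 + δ d) * ((d : ℝ) / Real.log (d : ℝ)))) ∧
    (∀ ω : ℕ → ℕ, Tendsto (fun d : ℕ => (ω d : ℝ) / (d : ℝ)) atTop atTop →
      ∃ δ : ℕ → ℝ, Tendsto δ atTop (𝓝 0) ∧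
        ∀ d : ℕ, 2 ≤ d →
          FracDP.chiDP (completeBipartiteGraph (Fin d) (Fin (ω d))) =
            ENNReal.ofReal ((1 + δ d) * ((d : ℝ) / Real.log (d : ℝ)))) := by
  exact ⟨FracDP.exists_chiDP_le_of_isDegenerate, FracDP.exists_chiDP_completeBipartiteGraph_eq⟩
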